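/- Consider the polynomial ring $\mathbb C[A,B,A',B']$, graded with $A,B,A',B'$ in degree $1$. Let $V$ be the tensor square of the two-dimensional irreducible representation of $S_3$, spanned by vectors $x_0,x_1,x_2$ with $x_0+x_1+x_2=0$ permuted by $S_3$. The wreath product $S_3\wr S_2=(S_3)^2\rtimes S_2$ acts on $V$: each factor $S_3$ acts on one tensor factor, and $S_2$ exchanges the tensor factors. Setting $A=x_0\otimes x_0$, $B=x_1\otimes x_0$, $A'=x_0\otimes x_1$, $B'=x_1\otimes x_1$ identifies the symmetric algebra $S(V)$ with $\mathbb C[A,B,A',B']$. Let $\mathbb A=\mathbb C[A,B,A',B']^{S_3\wr S_2}$ be the graded ring of invariants; equivalently, $\mathbb A$ is the ring of polynomials invariant under the replacements of $(A,B,A',B')$ by $(B,A,B',A')$, by $(B,-A-B,B',-A'-B')$ and by $(A,A',B,B')$. For $k\ge 0$ the polynomial $$\tilde\sigma_k=A^k+B^k+(-A-B)^k+A'^k+B'^k+(-A'-B')^k+(-A-A')^k+(-B-B')^k+(A+B+A'+B')^k$$ belongs to $\mathbb A$. Then the graded ring $\mathbb A$ has the following presentation. It is generated as a $\mathbb C$-algebra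 by $\tilde\sigma_2,\tilde\sigma_3,\tilde\sigma_4,\tilde\sigma_5,\tilde\sigma_6$, where $\tilde\sigma_i$ is nonzero and homogeneous of degree $i$. The kernel of the algebra morphism $\mathbb C[x_2,x_3,x_4,x_5,x_6]\to\mathbb A$, $x_i\mapsto\tilde\sigma_i$, is the ideal generated by $$x_5^2-\tfrac{25}{18}x_2x_3x_5+\Big(\tfrac{275}{108}x_4-\tfrac{25}{162}x_2^2\Big)x_3^2+\Big(x_4-\tfrac14x_2^2\Big)\Big(-\tfrac{125}{432}x_2^3+\tfrac{175}{72}x_2x_4-\tfrac{25}{6}x_6\Big).$$ Moreover $\tilde\sigma_2,\tilde\sigma_3,\tilde\sigma_4,\tilde\sigma_6$ are algebraically independent over $\mathbb C$, the homogeneous parts $\mathbb A_n$ of $\mathbb A$ are finite dimensional, and the Hilbert series of $\mathbb A$ is $$\sum_{n\ge0}\dim_{\mathbb C}(\mathbb A_n)\,t^n=\frac{1+t^5}{(1-t^2)(1-t^3)(1-t^4)(1-t^6)}.$$ -/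

import Mathlib

/-! The polynomial ring `ℂ[A, B, A', B']`, the action of the wreath product `S₃ ≀ S₂` on it,
its graded ring of invariants, and the power sums `σ̃ₖ`. -/

namespace WreathInvariants

open MvPolynomial

noncomputable section

/-- The polynomial ring `ℂ[A, B, A', B']`, with variables `A = X 0`, `B = X 1`, `A' = X 2`,
`B' = X 3`. -/
abbrev Poly : Type := MvPolynomial (Fin 4) ℂ

/-- The variable `A`. -/
def vA : Poly := X 0
/-- The variable `B`. -/
def vB : Poly := X 1
/-- The variable `A'`. -/
def vA' : Poly := X 2
/-- The variable `B'`. -/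
def vB' : Poly := X 3

/-- The wreath product `S₃ ≀ S₂ = (S₃)² ⋊ S₂`, where `S₂` permutes the two factors. -/
abbrev Wreath : Type :=
  (Fin 2 → Equiv.Perm (Fin 3)) ⋊[(mulAutArrow :
    Equiv.Perm (Fin 2) →* MulAut (Fin 2 → Equiv.Perm (Fin 3)))] Equiv.Perm (Fin 2)

/-- The product action of `S₃ ≀ S₂` on `{0,1,2}²`: the base group acts coordinatewise, `S₂`
permutes the coordinates. -/
def move (g : Wreath) (c : Fin 2 → Fin 3) : Fin 2 → Fin 3 :=
  fun k => g.left k (c (g.right⁻¹ k))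

/-- The `3 × 3` matrix with zero row and column sums whose upper left block is
`(A, B; A', B')`. With `x₀, x₁, x₂` (`x₀ + x₁ + x₂ = 0`) spanning the two-dimensional irreducible
representation of `S₃`, its entry in row `j` and column `i` is the vector `xᵢ ⊗ xⱼ` of the tensor
square. -/
def entryMatrix : Matrix (Fin 3) (Fin 3) Poly :=
  !![vA, vB, -vA - vB;
     vA', vB', -vA' - vB';
     -vA - vA', -vB - vB', vA + vB + vA' + vB']

/-- The vector `x_{c 0} ⊗ x_{c 1}`, as a linear form in `A, B, A', B'`. -/
def entry (c : Fin 2 → Fin 3) : Poly := entryMatrix (c 1) (c 0)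

/-- The algebra endomorphism of `ℂ[A, B, A', B'] = S(V)` given by `g ∈ S₃ ≀ S₂`: it maps
`A, B, A', B'`, that is `x₀⊗x₀, x₁⊗x₀, x₀⊗x₁, x₁⊗x₁`, to their images under `g`. -/
def actHom (g : Wreath) : Poly →ₐ[ℂ] Poly :=
  aeval ![entry (move g ![0, 0]), entry (move g ![1, 0]),
          entry (move g ![0, 1]), entry (move g ![1, 1])]

theorem move_one (c : Fin 2 → Fin 3) : move 1 c = c := by
  funext k; simp [move]

theorem move_mul (g h : Wreath) (c : Fin 2 → Fin 3) : move (g * h) c = move g (move h c) := by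
  funext k
  simp only [move, SemidirectProduct.mul_left, SemidirectProduct.mul_right, Pi.mul_apply,
    Equiv.Perm.mul_apply, mul_inv_rev]
  rfl

theorem entryMatrix_row_sum (p : Equiv.Perm (Fin 3)) (j : Fin 3) :
    entryMatrix j (p 0) + entryMatrix j (p 1) + entryMatrix j (p 2) = 0 := by
  have h := Equiv.sum_comp p (fun i => entryMatrix j i)
  rw [Fin.sum_univ_three, Fin.sum_univ_three] at h
  rw [h]
  fin_cases j <;> (simp [entryMatrix]; try ring)

theorem entryMatrix_col_sum (p : Equiv.Perm (Fin 3)) (i : Fin 3) :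
    entryMatrix (p 0) i + entryMatrix (p 1) i + entryMatrix (p 2) i = 0 := by
  have h := Equiv.sum_comp p (fun j => entryMatrix j i)
  rw [Fin.sum_univ_three, Fin.sum_univ_three] at h
  rw [h]
  fin_cases i <;> (simp [entryMatrix]; try ring)

theorem perm_two (s : Equiv.Perm (Fin 2)) : s = 1 ∨ s = Equiv.swap 0 1 := by
  revert s; decide

theorem entry_move_sum_left (g : Wreath) (j : Fin 3) :
    entry (move g ![0, j]) + entry (move g ![1, j]) + entry (move g ![2, j]) = 0 := by
  obtain ⟨n, s⟩ := g
  rcases perm_two s with rfl | rfl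
  · simpa [entry, move] using entryMatrix_row_sum (n 0) (n 1 j)
  · simpa [entry, move] using entryMatrix_col_sum (n 1) (n 0 j)

theorem entry_move_sum_right (g : Wreath) (i : Fin 3) :
    entry (move g ![i, 0]) + entry (move g ![i, 1]) + entry (move g ![i, 2]) = 0 := by
  obtain ⟨n, s⟩ := g
  rcases perm_two s with rfl | rfl
  · simpa [entry, move] using entryMatrix_col_sum (n 1) (n 0 i)
  · simpa [entry, move] using entryMatrix_row_sum (n 0) (n 1 i)

/-- The action permutes the nine entries of the matrix. -/
theorem actHom_entry (g : Wreath) (c : Fin 2 → Fin 3) :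
    actHom g (entry c) = entry (move g c) := by
  obtain ⟨i, j, rfl⟩ : ∃ i j, c = ![i, j] := ⟨c 0, c 1, by funext k; fin_cases k <;> rfl⟩
  have hA : actHom g vA = entry (move g ![0, 0]) := by simp [actHom, vA]
  have hB : actHom g vB = entry (move g ![1, 0]) := by simp [actHom, vB]
  have hA' : actHom g vA' = entry (move g ![0, 1]) := by simp [actHom, vA']
  have hB' : actHom g vB' = entry (move g ![1, 1]) := by simp [actHom, vB']
  have l0 := entry_move_sum_left g 0
  have l1 := entry_move_sum_left g 1
  have l2 := entry_move_sum_left g 2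
  have r0 := entry_move_sum_right g 0
  have r1 := entry_move_sum_right g 1
  have r2 := entry_move_sum_right g 2
  fin_cases i <;> fin_cases j
  · exact hA
  · exact hA'
  · change actHom g (-vA - vA') = entry (move g ![0, 2])
    rw [map_sub, map_neg, hA, hA']; linear_combination -r0
  · exact hB
  · exact hB'
  · change actHom g (-vB - vB') = entry (move g ![1, 2])
    rw [map_sub, map_neg, hB, hB']; linear_combination -r1
  · change actHom g (-vA - vB) = entry (move g ![2, 0])
    rw [map_sub, map_neg, hA, hB]; linear_combination -l0
  · change actHom g (-vA' - vB') = entry (move g ![2, 1])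
    rw [map_sub, map_neg, hA', hB']; linear_combination -l1
  · change actHom g (vA + vB + vA' + vB') = entry (move g ![2, 2])
    rw [map_add, map_add, map_add, hA, hB, hA', hB']
    linear_combination l0 + l1 - r2

theorem actHom_one : actHom 1 = AlgHom.id ℂ Poly := by
  refine MvPolynomial.algHom_ext fun i => ?_
  fin_cases i <;> simp [actHom, move_one] <;> rfl

theorem actHom_mul (g h : Wreath) : actHom (g * h) = (actHom g).comp (actHom h) := by
  refine MvPolynomial.algHom_ext fun i => ?_
  fin_cases i <;> simp [actHom, move_mul] <;> exact (actHom_entry g _).symm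

/-- The action of `S₃ ≀ S₂` on `ℂ[A, B, A', B']` by algebra automorphisms. -/
instance : MulSemiringAction Wreath Poly where
  smul g p := actHom g p
  one_smul p := DFunLike.congr_fun actHom_one p
  mul_smul g h p := DFunLike.congr_fun (actHom_mul g h) p
  smul_zero g := map_zero (actHom g)
  smul_add g := map_add (actHom g)
  smul_one g := map_one (actHom g)
  smul_mul g := map_mul (actHom g)

theorem smul_def (g : Wreath) (p : Poly) : g • p = actHom g p := rfl

instance : SMulCommClass Wreath ℂ Poly where
  smul_comm g z p := map_smul (actHom g) z p

/-- The invariant ring `𝔸 = ℂ[A, B, A', B']^{S₃ ≀ S₂}`. -/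
abbrev invariantRing : Subalgebra ℂ Poly := FixedPoints.subalgebra ℂ Poly Wreath

/-- The substitutions `(A, B, A', B') ↦ (B, A, B', A')`, `(B, -A-B, B', -A'-B')` and
`(A, A', B, B')`. -/
def sub₁ : Poly →ₐ[ℂ] Poly := aeval ![vB, vA, vB', vA']
/-- See `sub₁`. -/
def sub₂ : Poly →ₐ[ℂ] Poly := aeval ![vB, -vA - vB, vB', -vA' - vB']
/-- See `sub₁`. -/
def sub₃ : Poly →ₐ[ℂ] Poly := aeval ![vA, vA', vB, vB']

theorem perm_three_mem (H : Subgroup (Equiv.Perm (Fin 3))) (h₁ : Equiv.swap 0 1 ∈ H)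
    (h₂ : finRotate 3 ∈ H) (p : Equiv.Perm (Fin 3)) : p ∈ H := by
  have : p = 1 ∨ p = Equiv.swap 0 1 ∨ p = finRotate 3 ∨ p = finRotate 3 * finRotate 3 ∨
      p = Equiv.swap 0 1 * finRotate 3 ∨ p = Equiv.swap 0 1 * (finRotate 3 * finRotate 3) := by
    revert p; decide
  rcases this with rfl | rfl | rfl | rfl | rfl | rfl
  · exact H.one_mem
  · exact h₁
  · exact h₂
  · exact H.mul_mem h₂ h₂
  · exact H.mul_mem h₁ h₂
  · exact H.mul_mem h₁ (H.mul_mem h₂ h₂)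

/-- The invariants of `S₃ ≀ S₂` are the polynomials fixed by the three substitutions. -/
theorem mem_invariantRing_iff (p : Poly) :
    p ∈ invariantRing ↔ sub₁ p = p ∧ sub₂ p = p ∧ sub₃ p = p := by
  let b : Equiv.Perm (Fin 3) →* Wreath :=
    SemidirectProduct.inl.comp (MonoidHom.mulSingle (fun _ : Fin 2 => Equiv.Perm (Fin 3)) 0)
  let w : Wreath := SemidirectProduct.inr (Equiv.swap 0 1)
  have e₁ : actHom (b (Equiv.swap 0 1)) = sub₁ := by
    refine MvPolynomial.algHom_ext fun i => ?_
    fin_cases i <;> simp [actHom, sub₁, entry, move, b] <;> rfl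
  have e₂ : actHom (b (finRotate 3)) = sub₂ := by
    refine MvPolynomial.algHom_ext fun i => ?_
    fin_cases i <;> simp [actHom, sub₂, entry, move, b] <;> rfl
  have e₃ : actHom w = sub₃ := by
    refine MvPolynomial.algHom_ext fun i => ?_
    fin_cases i <;> simp [actHom, sub₃, entry, move, w] <;> rfl
  rw [← e₁, ← e₂, ← e₃]
  constructor
  · intro h
    exact ⟨h _, h _, h _⟩
  · rintro ⟨h₁, h₂, h₃⟩ g
    change g ∈ MulAction.stabilizer Wreath p
    have hb : ∀ q, b q ∈ MulAction.stabilizer Wreath p :=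
      perm_three_mem ((MulAction.stabilizer Wreath p).comap b) h₁ h₂
    have hw : w ∈ MulAction.stabilizer Wreath p := h₃
    have hs : SemidirectProduct.inr g.right ∈ MulAction.stabilizer Wreath p := by
      rcases perm_two g.right with h | h <;> rw [h]
      · rw [map_one]; exact Subgroup.one_mem _
      · exact hw
    have key : g = b (g.left 0) * (w * b (g.left 1) * w) * SemidirectProduct.inr g.right := by
      refine SemidirectProduct.ext ?_ ?_
      · funext k
        fin_cases k
        · simp only [b, w, Fin.zero_eta, MonoidHom.comp_apply, SemidirectProduct.mul_left,
            SemidirectProduct.left_inl, SemidirectProduct.left_inr, SemidirectProduct.right_inl,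
            SemidirectProduct.right_inr, map_one, MulAut.one_apply, Pi.mul_apply, Pi.one_apply,
            one_mul, mul_one, MonoidHom.mulSingle_apply, Pi.mulSingle_eq_same]
          change g.left 0 = g.left 0 * Pi.mulSingle (M := fun _ => Equiv.Perm (Fin 3)) 0 (g.left 1)
            ((Equiv.swap 0 1 : Equiv.Perm (Fin 2))⁻¹ 0)
          simp
        · simp only [b, w, Fin.mk_one, MonoidHom.comp_apply, SemidirectProduct.mul_left,
            SemidirectProduct.left_inl, SemidirectProduct.left_inr, SemidirectProduct.right_inl,
            SemidirectProduct.right_inr, map_one, MulAut.one_apply, Pi.mul_apply, Pi.one_apply,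
            one_mul, mul_one, MonoidHom.mulSingle_apply]
          change g.left 1 = Pi.mulSingle (M := fun _ => Equiv.Perm (Fin 3)) 0 (g.left 0) 1 *
            Pi.mulSingle (M := fun _ => Equiv.Perm (Fin 3)) 0 (g.left 1)
              ((Equiv.swap 0 1 : Equiv.Perm (Fin 2))⁻¹ 1)
          simp
      · simp [b, w]
    rw [key]
    exact Subgroup.mul_mem _ (Subgroup.mul_mem _ (hb _)
      (Subgroup.mul_mem _ (Subgroup.mul_mem _ hw (hb _)) hw)) hs

/-- The polynomial `σ̃ₖ`. -/
def sigmaTilde (k : ℕ) : Poly :=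
  vA ^ k + vB ^ k + (-vA - vB) ^ k + vA' ^ k + vB' ^ k + (-vA' - vB') ^ k
    + (-vA - vA') ^ k + (-vB - vB') ^ k + (vA + vB + vA' + vB') ^ k

theorem sigmaTilde_mem (k : ℕ) : sigmaTilde k ∈ invariantRing := by
  rw [mem_invariantRing_iff]
  refine ⟨?_, ?_, ?_⟩
  all_goals
    simp only [sub₁, sub₂, sub₃, sigmaTilde, vA, vB, vA', vB', map_add, map_sub, map_neg, map_pow,
      aeval_X, Matrix.cons_val]
    ring_nf

/-- The element `σ̃ₖ` of the invariant ring. -/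
def sigma (k : ℕ) : invariantRing := ⟨sigmaTilde k, sigmaTilde_mem k⟩

/-- The part of degree `n` of the invariant ring, for the grading in which `A, B, A', B'` have
degree `1`. -/
def gradedPart (n : ℕ) : Submodule ℂ invariantRing :=
  (homogeneousSubmodule (Fin 4) ℂ n).comap invariantRing.val.toLinearMap

/-- The Hilbert series of the invariant ring. -/
def hilbertSeries : PowerSeries ℚ :=
  PowerSeries.mk fun n => (Module.finrank ℂ (gradedPart n) : ℚ)

/-- The morphism `ℂ[x₂, x₃, x₄, x₅, x₆] → 𝔸`, `xᵢ ↦ σ̃ᵢ`; the variable `xᵢ` is `X (i - 2)`. -/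
def presentation : MvPolynomial (Fin 5) ℂ →ₐ[ℂ] invariantRing :=
  aeval ![sigma 2, sigma 3, sigma 4, sigma 5, sigma 6]

/-- The relation, as a polynomial in `x₂, x₃, x₄, x₅, x₆`. -/
def relation : MvPolynomial (Fin 5) ℂ :=
  let x₂ : MvPolynomial (Fin 5) ℂ := X 0
  let x₃ : MvPolynomial (Fin 5) ℂ := X 1
  let x₄ : MvPolynomial (Fin 5) ℂ := X 2
  let x₅ : MvPolynomial (Fin 5) ℂ := X 3
  let x₆ : MvPolynomial (Fin 5) ℂ := X 4
  x₅ ^ 2 - C (25 / 18) * x₂ * x₃ * x₅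
    + (C (275 / 108) * x₄ - C (25 / 162) * x₂ ^ 2) * x₃ ^ 2
    + (x₄ - C (1 / 4) * x₂ ^ 2)
      * (-C (125 / 432) * x₂ ^ 3 + C (175 / 72) * x₂ * x₄ - C (25 / 6) * x₆)

end

end WreathInvariants

/-! Extracting the eigenvectors of the normal subgroup C₃ × C₃ gives coordinates `ya`, `yb`, `yc`,
`yd` in which the group looks different: one copy of S₃ acts on `ya`, `yd` by its reflection
representation and fixes `yb`, `yc`, a second copy does the reverse, and a further involution
exchanges the two planes. Each plane has the basic invariants xy and x³ + y³. In terms of their sums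
s₂, s₃ and differences δ₂, δ₃ over the two planes, the exchange fixes s₂, s₃ and negates δ₂, δ₃, so
the invariants are the polynomials in s₂, s₃, δ₂, δ₃ that are even in (δ₂, δ₃): they are generated
by s₂, s₃, δ₂², δ₂δ₃, δ₃² (`invariantRing_le`).

The power sums of degrees 2, 3, 4, 5, 6 are, triangularly and with nonzero leading scalars, these
five generators, hence generate. Those of degrees 2, 3, 4, 6 are algebraically independent because
the whole polynomial ring is integral over them (`algebraicIndependent_primary`).

After completing the square in x₅, the relation says (δ₂δ₃)² = δ₂² · δ₃² up to scalars
(`relation_eq`, `centered_sq`). It is the only one: it is monic of degree 2 in x₅, and its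
discriminant has a prime factor of odd multiplicity, so 1 and σ̃₅ are independent over P = ℂ[σ̃₂,
σ̃₃, σ̃₄, σ̃₆]. Thus 𝔸 = P ⊕ σ̃₅P, which gives the Hilbert series. -/

namespace WreathInvariants

open MvPolynomial

noncomputable section

/-! ### Eigencoordinates of C₃ × C₃. -/

/-- A primitive cube root of unity. -/
def omega : ℂ := ⟨-1 / 2, √3 / 2⟩

theorem omega_sq_add : omega ^ 2 + omega + 1 = 0 := by
  have h : (√3 : ℝ) * √3 = 3 := Real.mul_self_sqrt (by norm_num)
  refine Complex.ext ?_ ?_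
  · simp [omega, pow_two, Complex.mul_re]; nlinarith
  · simp [omega, pow_two, Complex.mul_im]; ring

/-- The cube root of unity as a constant polynomial. -/
def zeta : Poly := C omega

theorem zeta_sq : zeta ^ 2 = -zeta - 1 := by
  have h := congrArg (C : ℂ →+* Poly) omega_sq_add
  simp only [map_add, map_pow, map_one, map_zero] at h
  unfold zeta
  linear_combination h

theorem zeta_pow_three : zeta ^ 3 = 1 := by
  linear_combination (zeta - 1) * zeta_sq

/-- The constant polynomial `1 / 9`. -/
def ninth : Poly := C (1 / 9)

theorem nine_mul_ninth : 9 * ninth = 1 := by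
  rw [ninth, show (9 : Poly) = C 9 from (map_ofNat C 9).symm, ← C_mul]
  norm_num

/-- The coordinate `w ⊗ w`, up to a scalar, where `w = x₀ + ω x₁ + ω² x₂`. -/
def ya : Poly := ninth * ((vA + zeta * vB + zeta ^ 2 * (-vA - vB))
  + zeta * (vA' + zeta * vB' + zeta ^ 2 * (-vA' - vB'))
  + zeta ^ 2 * (-vA - vA' + zeta * (-vB - vB') + zeta ^ 2 * (vA + vB + vA' + vB')))
/-- The coordinate `w ⊗ w̄`, up to a scalar. -/
def yb : Poly := ninth * ((vA + zeta * vB + zeta ^ 2 * (-vA - vB))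
  + zeta ^ 2 * (vA' + zeta * vB' + zeta ^ 2 * (-vA' - vB'))
  + zeta * (-vA - vA' + zeta * (-vB - vB') + zeta ^ 2 * (vA + vB + vA' + vB')))
/-- The coordinate `w̄ ⊗ w`, up to a scalar. -/
def yc : Poly := ninth * ((vA + zeta ^ 2 * vB + zeta * (-vA - vB))
  + zeta * (vA' + zeta ^ 2 * vB' + zeta * (-vA' - vB'))
  + zeta ^ 2 * (-vA - vA' + zeta ^ 2 * (-vB - vB') + zeta * (vA + vB + vA' + vB')))
/-- The coordinate `w̄ ⊗ w̄`, up to a scalar. -/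
def yd : Poly := ninth * ((vA + zeta ^ 2 * vB + zeta * (-vA - vB))
  + zeta ^ 2 * (vA' + zeta ^ 2 * vB' + zeta * (-vA' - vB'))
  + zeta * (-vA - vA' + zeta ^ 2 * (-vB - vB') + zeta * (vA + vB + vA' + vB')))

theorem vA_eq : vA = ya + yb + yc + yd := by
  have h := zeta_sq
  have h9 := nine_mul_ninth
  unfold ya yb yc yd
  grind
theorem vB_eq : vB = zeta ^ 2 * ya + zeta ^ 2 * yb + zeta * yc + zeta * yd := by
  have h := zeta_sq
  have h9 := nine_mul_ninth
  unfold ya yb yc yd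
  grind
theorem vA'_eq : vA' = zeta ^ 2 * ya + zeta * yb + zeta ^ 2 * yc + zeta * yd := by
  have h := zeta_sq
  have h9 := nine_mul_ninth
  unfold ya yb yc yd
  grind
theorem vB'_eq : vB' = zeta * ya + yb + yc + zeta ^ 2 * yd := by
  have h := zeta_sq
  have h9 := nine_mul_ninth
  unfold ya yb yc yd
  grind

theorem sub₁_const (r : ℂ) : sub₁ (C r) = C r := sub₁.commutes r
theorem sub₂_const (r : ℂ) : sub₂ (C r) = C r := sub₂.commutes r
theorem sub₃_const (r : ℂ) : sub₃ (C r) = C r := sub₃.commutes r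

theorem sub₂_coord : sub₂ ya = zeta ^ 2 * ya ∧ sub₂ yb = zeta ^ 2 * yb ∧ sub₂ yc = zeta * yc ∧
    sub₂ yd = zeta * yd := by
  have h := zeta_sq
  have hA : sub₂ vA = vB := by simp [sub₂, vA]
  have hB : sub₂ vB = -vA - vB := by simp [sub₂, vB]
  have hA' : sub₂ vA' = vB' := by simp [sub₂, vA']
  have hB' : sub₂ vB' = -vA' - vB' := by simp [sub₂, vB']
  have hz : sub₂ zeta = zeta := sub₂_const _
  have hn : sub₂ ninth = ninth := sub₂_const _
  refine ⟨?_, ?_, ?_, ?_⟩ <;>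
  simp only [ya, yb, yc, yd, map_mul, map_add, map_sub, map_neg, map_pow, hA, hB, hA', hB', hz, hn]
    <;> grind

theorem sub₁_coord : sub₁ ya = zeta * yc ∧ sub₁ yb = zeta * yd ∧ sub₁ yc = zeta ^ 2 * ya ∧
    sub₁ yd = zeta ^ 2 * yb := by
  have h := zeta_sq
  have hA : sub₁ vA = vB := by simp [sub₁, vA]
  have hB : sub₁ vB = vA := by simp [sub₁, vB]
  have hA' : sub₁ vA' = vB' := by simp [sub₁, vA']
  have hB' : sub₁ vB' = vA' := by simp [sub₁, vB']
  have hz : sub₁ zeta = zeta := sub₁_const _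
  have hn : sub₁ ninth = ninth := sub₁_const _
  refine ⟨?_, ?_, ?_, ?_⟩ <;>
  simp only [ya, yb, yc, yd, map_mul, map_add, map_sub, map_neg, map_pow, hA, hB, hA', hB', hz, hn]
    <;> grind

theorem sub₃_coord : sub₃ ya = ya ∧ sub₃ yb = yc ∧ sub₃ yc = yb ∧ sub₃ yd = yd := by
  have hA : sub₃ vA = vA := by simp [sub₃, vA]
  have hB : sub₃ vB = vA' := by simp [sub₃, vB, vA']
  have hA' : sub₃ vA' = vB := by simp [sub₃, vA', vB]
  have hB' : sub₃ vB' = vB' := by simp [sub₃, vB']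
  have hz : sub₃ zeta = zeta := sub₃_const _
  have hn : sub₃ ninth = ninth := sub₃_const _
  refine ⟨?_, ?_, ?_, ?_⟩ <;>
  simp only [ya, yb, yc, yd, map_mul, map_add, map_sub, map_neg, map_pow, hA, hB, hA', hB', hz, hn]
    <;> ring

/-! ### Basic invariants and the power sums expressed through them. -/

/-- The sum of the basic invariants of degree `2` of the two reflection representations. -/
def sum₂ : Poly := ya * yd + yb * yc
/-- The difference of the basic invariants of degree `2`. -/
def diff₂ : Poly := ya * yd - yb * yc
/-- The sum of the basic invariants of degree `3`. -/
def sum₃ : Poly := ya ^ 3 + yd ^ 3 + (yb ^ 3 + yc ^ 3)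
/-- The difference of the basic invariants of degree `3`. -/
def diff₃ : Poly := ya ^ 3 + yd ^ 3 - (yb ^ 3 + yc ^ 3)


theorem sigmaTilde_eq (k : ℕ) : sigmaTilde k =
    (ya + yb + yc + yd) ^ k + (zeta ^ 2 * (ya + yb) + zeta * (yc + yd)) ^ k
      + (zeta * (ya + yb) + zeta ^ 2 * (yc + yd)) ^ k
    + (zeta ^ 2 * (ya + yc) + zeta * (yb + yd)) ^ k + (zeta * ya + yb + yc + zeta ^ 2 * yd) ^ k
      + (ya + zeta ^ 2 * yb + zeta * yc + yd) ^ k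
    + (zeta * (ya + yc) + zeta ^ 2 * (yb + yd)) ^ k + (ya + zeta * yb + zeta ^ 2 * yc + yd) ^ k
      + (zeta ^ 2 * ya + yb + yc + zeta * yd) ^ k := by
  have h := zeta_sq
  have e1 : -vA - vB = zeta * (ya + yb) + zeta ^ 2 * (yc + yd) := by
    rw [vA_eq, vB_eq]; grind
  have e2 : -vA' - vB' = ya + zeta ^ 2 * yb + zeta * yc + yd := by
    rw [vA'_eq, vB'_eq]; grind
  have e3 : -vA - vA' = zeta * (ya + yc) + zeta ^ 2 * (yb + yd) := by
    rw [vA_eq, vA'_eq]; grind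
  have e4 : -vB - vB' = ya + zeta * yb + zeta ^ 2 * yc + yd := by
    rw [vB_eq, vB'_eq]; grind
  have e5 : vA + vB + vA' + vB' = zeta ^ 2 * ya + yb + yc + zeta * yd := by
    rw [vA_eq, vB_eq, vA'_eq, vB'_eq]; grind
  rw [sigmaTilde, e1, e2, e3, e4, e5, vA_eq, vB_eq, vA'_eq, vB'_eq]
  ring

theorem sigmaTilde_two : sigmaTilde 2 = 18 * sum₂ := by
  have h := zeta_sq
  rw [sigmaTilde_eq, sum₂]
  grind

theorem sigmaTilde_three : sigmaTilde 3 = 9 * sum₃ := by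
  have h := zeta_sq
  rw [sigmaTilde_eq, sum₃]
  grind

theorem sigmaTilde_four : sigmaTilde 4 = 81 * sum₂ ^ 2 - 27 * diff₂ ^ 2 := by
  have h := zeta_sq
  rw [sigmaTilde_eq, sum₂, diff₂]
  grind

/-- Exchanging the two planes negates both differences, so only terms even in them can occur. The
factor 2 keeps the coefficients integral. -/
theorem two_mul_sigmaTilde_five :
    2 * sigmaTilde 5 = 225 * sum₂ * sum₃ - 135 * diff₂ * diff₃ := by
  have h := zeta_sq
  rw [sigmaTilde_eq, sum₂, diff₂, sum₃, diff₃]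
  grind

/-- Summing over the cube roots of unity kills every pⁱqʲ with i ≢ j mod 3. -/
theorem sum_pow_six (p q : Poly) : (p + q) ^ 6 + (zeta ^ 2 * p + zeta * q) ^ 6
    + (zeta * p + zeta ^ 2 * q) ^ 6 = 3 * (p ^ 6 + 20 * (p * q) ^ 3 + q ^ 6) := by
  have h := zeta_sq
  grind

theorem sum_cube (x y z : Poly) : (x + y + z) ^ 3 + (zeta * x + y + zeta ^ 2 * z) ^ 3
    + (zeta ^ 2 * x + y + zeta * z) ^ 3 = 3 * (x ^ 3 + y ^ 3 + z ^ 3 + 6 * (x * y * z)) := by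
  have h := zeta_sq
  grind

set_option maxHeartbeats 1000000 in
theorem two_mul_sigmaTilde_six : 2 * sigmaTilde 6 =
    99 * sum₃ ^ 2 - 81 * diff₃ ^ 2 + 891 * sum₂ ^ 3 - 567 * diff₂ ^ 2 * sum₂ := by
  have h := zeta_sq
  -- The nine linear forms split into three triples of the shape in `sum_pow_six`, one for each pair
  -- (p, q). Summing p⁶ and q⁶ over the triples is again `sum_pow_six`, while the cubes of the three
  -- products pq, expanded here, add up by `sum_cube`.
  have e₁ : (zeta ^ 2 * ya + zeta * yb) * (zeta ^ 2 * yc + zeta * yd) =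
    zeta * (ya * yc) + (ya * yd + yb * yc) + zeta ^ 2 * (yb * yd) := by grind
  have e₂ : (zeta * ya + zeta ^ 2 * yb) * (zeta * yc + zeta ^ 2 * yd) =
    zeta ^ 2 * (ya * yc) + (ya * yd + yb * yc) + zeta * (yb * yd) := by grind
  have l₁ : zeta ^ 2 * (zeta ^ 2 * ya + zeta * yb) + zeta * (zeta ^ 2 * yc + zeta * yd) =
    zeta * ya + yb + yc + zeta ^ 2 * yd := by grind
  have l₂ : zeta * (zeta ^ 2 * ya + zeta * yb) + zeta ^ 2 * (zeta ^ 2 * yc + zeta * yd) =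
    ya + zeta ^ 2 * yb + zeta * yc + yd := by grind
  have l₃ : zeta ^ 2 * (zeta * ya + zeta ^ 2 * yb) + zeta * (zeta * yc + zeta ^ 2 * yd) =
    ya + zeta * yb + zeta ^ 2 * yc + yd := by grind
  have l₄ : zeta * (zeta * ya + zeta ^ 2 * yb) + zeta ^ 2 * (zeta * yc + zeta ^ 2 * yd) =
    zeta ^ 2 * ya + yb + yc + zeta * yd := by grind
  have r₁ := sum_pow_six (ya + yb) (yc + yd)
  have r₂ := sum_pow_six (zeta ^ 2 * ya + zeta * yb) (zeta ^ 2 * yc + zeta * yd)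
  have r₃ := sum_pow_six (zeta * ya + zeta ^ 2 * yb) (zeta * yc + zeta ^ 2 * yd)
  have c₁ := sum_pow_six ya yb
  have c₂ := sum_pow_six yc yd
  have m := sum_cube (ya * yc) (ya * yd + yb * yc) (yb * yd)
  rw [l₁, l₂, e₁] at r₂
  rw [l₃, l₄, e₂] at r₃
  rw [sigmaTilde_eq, sum₂, diff₂, sum₃, diff₃]
  linear_combination 2 * r₁ + 2 * r₂ + 2 * r₃ + 6 * c₁ + 6 * c₂ + 120 * m


/-! ### Generation of the invariants by averaging monomials. -/

theorem pow_add_pow_mem {R : Type*} [CommRing R] [Algebra ℂ R] (N : Subalgebra ℂ R) {x y : R}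
    (h₁ : x * y ∈ N) (h₂ : x ^ 3 + y ^ 3 ∈ N) (m : ℕ) : x ^ (3 * m) + y ^ (3 * m) ∈ N := by
  induction m using Nat.twoStepInduction with
  | zero => simpa using N.add_mem N.one_mem N.one_mem
  | one => simpa using h₂
  | more m ih₁ ih₂ =>
    -- Newton's recurrence for the power sums of x³ and y³.
    have e : x ^ (3 * (m + 2)) + y ^ (3 * (m + 2)) =
        (x ^ 3 + y ^ 3) * (x ^ (3 * (m + 1)) + y ^ (3 * (m + 1)))
          - (x * y) ^ 3 * (x ^ (3 * m) + y ^ (3 * m)) := by ring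
    rw [e]
    exact N.sub_mem (N.mul_mem h₂ ih₂) (N.mul_mem (N.pow_mem h₁ 3) ih₁)

theorem symm_monomial_mem {R : Type*} [CommRing R] [Algebra ℂ R] (N : Subalgebra ℂ R) {x y : R}
    (h₁ : x * y ∈ N) (h₂ : x ^ 3 + y ^ 3 ∈ N) {i l : ℕ} (hil : i ≡ l [MOD 3]) :
    x ^ i * y ^ l + x ^ l * y ^ i ∈ N := by
  wlog hle : i ≤ l generalizing i l
  · rw [add_comm]; exact this hil.symm (by omega)
  obtain ⟨m, hm⟩ := (Nat.modEq_iff_dvd' hle).1 hil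
  obtain rfl : l = i + 3 * m := by omega
  have e : x ^ i * y ^ (i + 3 * m) + x ^ (i + 3 * m) * y ^ i =
      (x * y) ^ i * (x ^ (3 * m) + y ^ (3 * m)) := by ring
  rw [e]
  exact N.mul_mem (N.pow_mem h₁ i) (pow_add_pow_mem N h₁ h₂ m)

/-- The pairs `(u, v)` with `u = s + x s' + y s''` and `v = s - x s' - y s''` for `s`, `s'`, `s''`
in a subalgebra containing `x ^ 2`, `x y` and `y ^ 2`. -/
def conjugatePairs {R : Type*} [CommRing R] [Algebra ℂ R] (S : Subalgebra ℂ R) (x y : R)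
    (hxx : x ^ 2 ∈ S) (hxy : x * y ∈ S) (hyy : y ^ 2 ∈ S) : Subalgebra ℂ (R × R) where
  carrier := {p | ∃ s ∈ S, ∃ t ∈ S, ∃ r ∈ S, p.1 = s + x * t + y * r ∧ p.2 = s - x * t - y * r}
  mul_mem' := by
    rintro p p' ⟨s, hs, t, ht, r, hr, e₁, e₂⟩ ⟨s', hs', t', ht', r', hr', e₁', e₂'⟩
    -- The products of two odd parts fall back into S, because x², xy and y² lie there.
    refine ⟨s * s' + x ^ 2 * (t * t') + x * y * (t * r' + r * t') + y ^ 2 * (r * r'), ?_,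
      s * t' + t * s', ?_, s * r' + r * s', ?_, ?_, ?_⟩
    · have := @S.mul_mem
      have := @S.add_mem
      aesop
    · exact S.add_mem (S.mul_mem hs ht') (S.mul_mem ht hs')
    · exact S.add_mem (S.mul_mem hs hr') (S.mul_mem hr hs')
    · rw [Prod.fst_mul, e₁, e₁']; ring
    · rw [Prod.snd_mul, e₂, e₂']; ring
  add_mem' := by
    rintro p p' ⟨s, hs, t, ht, r, hr, e₁, e₂⟩ ⟨s', hs', t', ht', r', hr', e₁', e₂'⟩
    refine ⟨s + s', S.add_mem hs hs', t + t', S.add_mem ht ht', r + r', S.add_mem hr hr', ?_, ?_⟩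
    · rw [Prod.fst_add, e₁, e₁']; ring
    · rw [Prod.snd_add, e₂, e₂']; ring
  algebraMap_mem' z := ⟨_, S.algebraMap_mem z, 0, S.zero_mem, 0, S.zero_mem, by simp, by simp⟩

/-- Symmetrizing a `C₃ × C₃`-invariant monomial gives a polynomial in the basic invariants. -/
theorem symmetrized_monomial_mem (S : Subalgebra ℂ Poly) (h₂ : sum₂ ∈ S) (h₃ : sum₃ ∈ S)
    (h₄ : diff₂ ^ 2 ∈ S) (h₅ : diff₂ * diff₃ ∈ S) (h₆ : diff₃ ^ 2 ∈ S) {i j k l : ℕ}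
    (hil : i ≡ l [MOD 3]) (hjk : j ≡ k [MOD 3]) :
    (ya ^ i * yd ^ l + ya ^ l * yd ^ i) * (yb ^ j * yc ^ k + yb ^ k * yc ^ j)
      + (yc ^ i * yb ^ l + yc ^ l * yb ^ i) * (yd ^ j * ya ^ k + yd ^ k * ya ^ j) ∈ S := by
  -- Each element is paired with its image under the exchange `ya` ↔ `yc`, `yb` ↔ `yd`, which
  -- negates `diff₂` and `diff₃`. Working in `Poly × Poly` lets `symm_monomial_mem` treat both at
  -- once.
  let N := conjugatePairs S diff₂ diff₃ h₄ h₅ h₆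
  have c₁ : 2 * (C (1 / 2) : Poly) = 1 := by
    rw [show (2 : Poly) = C 2 from (map_ofNat C 2).symm, ← C_mul]; norm_num
  have hc : (C (1 / 2) : Poly) ∈ S := S.algebraMap_mem _
  have m₁ : ((ya, yc) * (yd, yb) : Poly × Poly) ∈ N :=
    ⟨C (1 / 2) * sum₂, S.mul_mem hc h₂, C (1 / 2), hc, 0, S.zero_mem, by
      simp only [Prod.fst_mul, sum₂, diff₂]; grind, by
      simp only [Prod.snd_mul, sum₂, diff₂]; grind⟩
  have m₂ : ((ya, yc) ^ 3 + (yd, yb) ^ 3 : Poly × Poly) ∈ N :=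
    ⟨C (1 / 2) * sum₃, S.mul_mem hc h₃, 0, S.zero_mem, C (1 / 2), hc, by
      simp only [Prod.fst_add, Prod.pow_fst, sum₃, diff₃]; grind, by
      simp only [Prod.snd_add, Prod.pow_snd, sum₃, diff₃]; grind⟩
  have m₃ : ((yb, yd) * (yc, ya) : Poly × Poly) ∈ N :=
    ⟨C (1 / 2) * sum₂, S.mul_mem hc h₂, -C (1 / 2), S.neg_mem hc, 0, S.zero_mem, by
      simp only [Prod.fst_mul, sum₂, diff₂]; grind, by
      simp only [Prod.snd_mul, sum₂, diff₂]; grind⟩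
  have m₄ : ((yb, yd) ^ 3 + (yc, ya) ^ 3 : Poly × Poly) ∈ N :=
    ⟨C (1 / 2) * sum₃, S.mul_mem hc h₃, 0, S.zero_mem, -C (1 / 2), S.neg_mem hc, by
      simp only [Prod.fst_add, Prod.pow_fst, sum₃, diff₃]; grind, by
      simp only [Prod.snd_add, Prod.pow_snd, sum₃, diff₃]; grind⟩
  obtain ⟨s, hs, t, -, r, -, e₁, e₂⟩ :=
    N.mul_mem (symm_monomial_mem N m₁ m₂ hil) (symm_monomial_mem N m₃ m₄ hjk)
  simp only [Prod.fst_mul, Prod.snd_mul, Prod.fst_add, Prod.snd_add, Prod.pow_fst,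
    Prod.pow_snd] at e₁ e₂
  -- The odd parts cancel in the sum of the two components.
  rw [e₁, e₂, show s + diff₂ * t + diff₃ * r + (s - diff₂ * t - diff₃ * r) = s + s by ring]
  exact S.add_mem hs hs

theorem adjoin_coord : Algebra.adjoin ℂ {ya, yb, yc, yd} = ⊤ := by
  rw [eq_top_iff, ← adjoin_range_X, Algebra.adjoin_le_iff]
  set T := Algebra.adjoin ℂ {ya, yb, yc, yd}
  have ha : ya ∈ T := Algebra.subset_adjoin (by simp)
  have hb : yb ∈ T := Algebra.subset_adjoin (by simp)
  have hc : yc ∈ T := Algebra.subset_adjoin (by simp)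
  have hd : yd ∈ T := Algebra.subset_adjoin (by simp)
  have hz : zeta ∈ T := T.algebraMap_mem _
  have hz2 : zeta ^ 2 ∈ T := T.pow_mem hz 2
  rintro _ ⟨i, rfl⟩
  fin_cases i
  · change vA ∈ T
    rw [vA_eq]
    exact T.add_mem (T.add_mem (T.add_mem ha hb) hc) hd
  · change vB ∈ T
    rw [vB_eq]
    exact T.add_mem (T.add_mem (T.add_mem (T.mul_mem hz2 ha) (T.mul_mem hz2 hb))
      (T.mul_mem hz hc)) (T.mul_mem hz hd)
  · change vA' ∈ T
    rw [vA'_eq]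
    exact T.add_mem (T.add_mem (T.add_mem (T.mul_mem hz2 ha) (T.mul_mem hz hb))
      (T.mul_mem hz2 hc)) (T.mul_mem hz hd)
  · change vB' ∈ T
    rw [vB'_eq]
    exact T.add_mem (T.add_mem (T.add_mem (T.mul_mem hz ha) hb) hc) (T.mul_mem hz2 hd)

theorem span_coord_monomials :
    Submodule.span ℂ (Set.range fun e : ℕ × ℕ × ℕ × ℕ =>
      ya ^ e.1 * yb ^ e.2.1 * yc ^ e.2.2.1 * yd ^ e.2.2.2) = ⊤ := by
  rw [← Algebra.top_toSubmodule, ← adjoin_coord, Algebra.adjoin_eq_span]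
  congr 1
  ext x
  constructor
  · rintro ⟨e, rfl⟩
    have h : ∀ y ∈ ({ya, yb, yc, yd} : Set Poly), y ∈ Submonoid.closure {ya, yb, yc, yd} :=
      fun y hy => Submonoid.subset_closure hy
    exact mul_mem (mul_mem (mul_mem (pow_mem (h _ (by simp)) _) (pow_mem (h _ (by simp)) _))
      (pow_mem (h _ (by simp)) _)) (pow_mem (h _ (by simp)) _)
  · intro hx
    induction hx using Submonoid.closure_induction with
    | mem x hx =>
      rcases hx with rfl | rfl | rfl | rfl
      · exact ⟨(1, 0, 0, 0), by simp⟩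
      · exact ⟨(0, 1, 0, 0), by simp⟩
      · exact ⟨(0, 0, 1, 0), by simp⟩
      · exact ⟨(0, 0, 0, 1), by simp⟩
    | one => exact ⟨(0, 0, 0, 0), by simp⟩
    | mul x y _ _ hx hy =>
      obtain ⟨e, rfl⟩ := hx
      obtain ⟨f, rfl⟩ := hy
      exact ⟨e + f, by simp only [Prod.fst_add, Prod.snd_add]; ring⟩

/-- The sum `1 + φ + φ ∘ φ`. -/
def sumOrbitThree (φ : Poly →ₐ[ℂ] Poly) : Poly →ₗ[ℂ] Poly :=
  LinearMap.id + φ.toLinearMap + φ.toLinearMap ∘ₗ φ.toLinearMap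

/-- The sum `1 + φ`. -/
def sumOrbitTwo (φ : Poly →ₐ[ℂ] Poly) : Poly →ₗ[ℂ] Poly := LinearMap.id + φ.toLinearMap

theorem sumOrbitThree_of_eigen {φ : Poly →ₐ[ℂ] Poly} (hφ : φ zeta = zeta) {p : Poly} {n : ℕ}
    (h : φ p = zeta ^ n * p) : sumOrbitThree φ p = if 3 ∣ n then 3 * p else 0 := by
  have e : sumOrbitThree φ p = (1 + zeta ^ n + (zeta ^ n) ^ 2) * p := by
    simp only [sumOrbitThree, LinearMap.add_apply, LinearMap.id_apply, LinearMap.comp_apply,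
      AlgHom.toLinearMap_apply, h, map_mul, map_pow, hφ]
    ring
  have hz := zeta_sq
  have e3 : zeta ^ n = zeta ^ (n % 3) := by
    conv_lhs => rw [← Nat.div_add_mod n 3, pow_add, pow_mul, zeta_pow_three, one_pow, one_mul]
  rw [e, e3]
  have : n % 3 < 3 := Nat.mod_lt _ (by norm_num)
  split_ifs with hd
  · rw [Nat.mod_eq_zero_of_dvd hd]; ring
  · have : n % 3 = 1 ∨ n % 3 = 2 := by omega
    rcases this with h | h <;> rw [h] <;> grind

/-- A subalgebra containing the basic invariants contains all invariants. -/
theorem invariantRing_le (S : Subalgebra ℂ Poly) (h₂ : sum₂ ∈ S) (h₃ : sum₃ ∈ S)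
    (h₄ : diff₂ ^ 2 ∈ S) (h₅ : diff₂ * diff₃ ∈ S) (h₆ : diff₃ ^ 2 ∈ S) : invariantRing ≤ S := by
  obtain ⟨a₁, b₁, c₁, d₁⟩ := sub₁_coord
  obtain ⟨a₂, b₂, c₂, d₂⟩ := sub₂_coord
  obtain ⟨a₃, b₃, c₃, d₃⟩ := sub₃_coord
  have hz1 : sub₁ zeta = zeta := sub₁_const _
  have hz2 : sub₂ zeta = zeta := sub₂_const _
  have hz3 : sub₃ zeta = zeta := sub₃_const _
  have hz := zeta_sq
  -- `r` is the rotation of the other tensor factor. The products φ₁ = `sub₂`·r and φ₂ = `sub₂`·r²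
  -- each rotate only one plane; φ₄ and `sub₃` are the reflections in the two planes, and s
  -- exchanges the planes.
  let r := sub₃.comp (sub₂.comp sub₃)
  let s := sub₁.comp sub₂
  let φ₁ := sub₂.comp r
  let φ₂ := φ₁.comp r
  let φ₄ := s.comp (sub₃.comp s)
  have ra : r ya = zeta ^ 2 * ya := by simp [r, *]
  have rb : r yb = zeta * yb := by simp [r, *]
  have rc : r yc = zeta ^ 2 * yc := by simp [r, *]
  have rd : r yd = zeta * yd := by simp [r, *]
  have rz : r zeta = zeta := by simp [r, hz2, hz3]
  have sa : s ya = yc := by simp only [s, AlgHom.comp_apply, map_mul, *]; grind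
  have sb : s yb = yd := by simp only [s, AlgHom.comp_apply, map_mul, *]; grind
  have sc : s yc = ya := by simp only [s, AlgHom.comp_apply, map_mul, *]; grind
  have sd : s yd = yb := by simp only [s, AlgHom.comp_apply, map_mul, *]; grind
  have φ₁z : φ₁ zeta = zeta := by simp [φ₁, rz, hz2]
  have φ₂z : φ₂ zeta = zeta := by simp [φ₂, φ₁z, rz]
  have φ₁a : φ₁ ya = zeta * ya := by simp only [φ₁, AlgHom.comp_apply, map_mul, *]; grind
  have φ₁b : φ₁ yb = yb := by simp only [φ₁, AlgHom.comp_apply, map_mul, *]; grind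
  have φ₁c : φ₁ yc = yc := by simp only [φ₁, AlgHom.comp_apply, map_mul, *]; grind
  have φ₁d : φ₁ yd = zeta ^ 2 * yd := by
    simp only [φ₁, AlgHom.comp_apply, map_mul, *]; grind
  have φ₂a : φ₂ ya = ya := by
    simp only [φ₂, AlgHom.comp_apply, map_mul, map_pow, ra, φ₁a, φ₁z]; grind
  have φ₂b : φ₂ yb = zeta * yb := by
    simp only [φ₂, AlgHom.comp_apply, map_mul, rb, φ₁b, φ₁z]
  have φ₂c : φ₂ yc = zeta ^ 2 * yc := by
    simp only [φ₂, AlgHom.comp_apply, map_mul, map_pow, rc, φ₁c, φ₁z]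
  have φ₂d : φ₂ yd = yd := by
    simp only [φ₂, AlgHom.comp_apply, map_mul, rd, φ₁d, φ₁z]; grind
  have φ₄a : φ₄ ya = yd := by simp [φ₄, sa, sb, c₃]
  have φ₄b : φ₄ yb = yb := by simp [φ₄, sb, sd, d₃]
  have φ₄c : φ₄ yc = yc := by simp [φ₄, sc, sa, a₃]
  have φ₄d : φ₄ yd = ya := by simp [φ₄, sd, sc, b₃]
  -- The sum over the group, factored into partial sums. On an invariant it is multiplication by 2 ·
  -- 2 · 2 · 3 · 3 = 72.
  let T : Poly →ₗ[ℂ] Poly := sumOrbitTwo s ∘ₗ sumOrbitTwo φ₄ ∘ₗ sumOrbitTwo sub₃ ∘ₗ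
    sumOrbitThree φ₂ ∘ₗ sumOrbitThree φ₁
  have hT : ∀ p, T p ∈ S := by
    suffices h : (⊤ : Submodule ℂ Poly) ≤ (Subalgebra.toSubmodule S).comap T from
      fun p => h Submodule.mem_top
    rw [← span_coord_monomials, Submodule.span_le]
    rintro _ ⟨⟨i, j, k, l⟩, rfl⟩
    change T (ya ^ i * yb ^ j * yc ^ k * yd ^ l) ∈ S
    have t₁ : φ₁ (ya ^ i * yb ^ j * yc ^ k * yd ^ l) =
        zeta ^ (i + 2 * l) * (ya ^ i * yb ^ j * yc ^ k * yd ^ l) := by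
      simp only [map_mul, map_pow, φ₁a, φ₁b, φ₁c, φ₁d]; ring
    have t₂ : φ₂ (3 * (ya ^ i * yb ^ j * yc ^ k * yd ^ l)) =
        zeta ^ (j + 2 * k) * (3 * (ya ^ i * yb ^ j * yc ^ k * yd ^ l)) := by
      simp only [map_mul, map_pow, φ₂a, φ₂b, φ₂c, φ₂d, map_ofNat]; ring
    simp only [T, LinearMap.comp_apply]
    rw [sumOrbitThree_of_eigen φ₁z t₁]
    split_ifs with hil
    -- If 3 does not divide the exponent of `zeta`, the partial sum already kills the monomial.
    swap
    · simp
    rw [sumOrbitThree_of_eigen φ₂z t₂]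
    split_ifs with hjk
    swap
    · simp
    have := symmetrized_monomial_mem S h₂ h₃ h₄ h₅ h₆ (i := i) (l := l) (j := j) (k := k)
      (by unfold Nat.ModEq; omega) (by unfold Nat.ModEq; omega)
    have := S.mul_mem (ofNat_mem S 9) this
    convert this using 1
    simp only [sumOrbitTwo, LinearMap.add_apply, LinearMap.id_apply, AlgHom.toLinearMap_apply,
      map_add, map_mul, map_pow, map_ofNat, sa, sb, sc, sd, φ₄a, φ₄b, φ₄c, φ₄d, a₃, b₃, c₃, d₃]
    ring
  intro p hp
  obtain ⟨p₁, p₂, p₃⟩ := (mem_invariantRing_iff p).1 hp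
  have pr : r p = p := by simp [r, p₂, p₃]
  have ps : s p = p := by simp [s, p₁, p₂]
  have q₁ : φ₁ p = p := by simp [φ₁, pr, p₂]
  have q₂ : φ₂ p = p := by simp [φ₂, pr, q₁]
  have q₄ : φ₄ p = p := by simp [φ₄, ps, p₃]
  have hTp : T p = (72 : ℂ) • p := by
    simp only [T, sumOrbitTwo, sumOrbitThree, LinearMap.comp_apply, LinearMap.add_apply,
      LinearMap.id_apply, AlgHom.toLinearMap_apply, map_add, ps, p₃, q₁, q₂, q₄]
    module
  have := S.smul_mem (hT p) (1 / 72 : ℂ)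
  rwa [hTp, smul_smul, show (1 / 72 * 72 : ℂ) = 1 by norm_num, one_smul] at this


/-! ### The five power sums generate. -/

/-- The constant polynomial `1 / 1296`. -/
def unitFrac : Poly := C (1 / 1296)

theorem unitFrac_spec : 1296 * unitFrac = 1 := by
  rw [unitFrac, show (1296 : Poly) = C 1296 from (map_ofNat C 1296).symm, ← C_mul]
  norm_num

/-- Rational constants become integer multiples of a single element u with 1296u = 1, so identities
between them reduce to integral ones modulo that equation. -/
theorem C_eq_unitFrac {z : ℂ} {n : ℕ} (h : z * 1296 = n) : (C z : Poly) = n * unitFrac := by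
  rw [unitFrac, show (n : Poly) = C (n : ℂ) from (map_natCast C n).symm, ← C_mul, ← h]
  congr 1
  ring

theorem sum₂_eq : sum₂ = 72 * unitFrac * sigmaTilde 2 := by
  rw [sigmaTilde_two]; linear_combination -sum₂ * unitFrac_spec
theorem sum₃_eq : sum₃ = 144 * unitFrac * sigmaTilde 3 := by
  rw [sigmaTilde_three]; linear_combination -sum₃ * unitFrac_spec
theorem diff₂_sq_eq : diff₂ ^ 2 = 48 * unitFrac * (81 * sum₂ ^ 2 - sigmaTilde 4) := by
  rw [sigmaTilde_four]; linear_combination -diff₂ ^ 2 * unitFrac_spec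
theorem diff₂_mul_diff₃_eq : 5 * (diff₂ * diff₃) = 48 * unitFrac *
    (225 * sum₂ * sum₃ - 2 * sigmaTilde 5) := by
  rw [two_mul_sigmaTilde_five]; linear_combination -(5 * (diff₂ * diff₃)) * unitFrac_spec
theorem diff₃_sq_eq : diff₃ ^ 2 = 16 * unitFrac *
    (99 * sum₃ ^ 2 + 891 * sum₂ ^ 3 - 567 * diff₂ ^ 2 * sum₂ - 2 * sigmaTilde 6) := by
  rw [two_mul_sigmaTilde_six]; linear_combination -diff₃ ^ 2 * unitFrac_spec

/-- The triangular system solved without σ̃₅, so that it also applies to the subalgebra generated by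
the other four power sums. -/
theorem basic_mem (S : Subalgebra ℂ Poly) (h₂ : sigmaTilde 2 ∈ S) (h₃ : sigmaTilde 3 ∈ S)
    (h₄ : sigmaTilde 4 ∈ S) (h₆ : sigmaTilde 6 ∈ S) :
    sum₂ ∈ S ∧ sum₃ ∈ S ∧ diff₂ ^ 2 ∈ S ∧ diff₃ ^ 2 ∈ S := by
  have hu : unitFrac ∈ S := S.algebraMap_mem _
  have n (k : ℕ) : (k : Poly) ∈ S := natCast_mem S k
  have hs₂ : sum₂ ∈ S := by
    rw [sum₂_eq]; exact S.mul_mem (S.mul_mem (n 72) hu) h₂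
  have hs₃ : sum₃ ∈ S := by
    rw [sum₃_eq]; exact S.mul_mem (S.mul_mem (n 144) hu) h₃
  have hd₂ : diff₂ ^ 2 ∈ S := by
    rw [diff₂_sq_eq]
    exact S.mul_mem (S.mul_mem (n 48) hu) (S.sub_mem (S.mul_mem (n 81) (S.pow_mem hs₂ 2)) h₄)
  refine ⟨hs₂, hs₃, hd₂, ?_⟩
  rw [diff₃_sq_eq]
  exact S.mul_mem (S.mul_mem (n 16) hu) (S.sub_mem (S.sub_mem (S.add_mem
    (S.mul_mem (n 99) (S.pow_mem hs₃ 2)) (S.mul_mem (n 891) (S.pow_mem hs₂ 3)))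
    (S.mul_mem (S.mul_mem (n 567) hd₂) hs₂)) (S.mul_mem (n 2) h₆))

/-- Here one must also divide by 5, which is prime to 1296, hence the scalar 1/5. -/
theorem diff₂_mul_diff₃_mem (S : Subalgebra ℂ Poly) (h₂ : sum₂ ∈ S) (h₃ : sum₃ ∈ S)
    (h₅ : sigmaTilde 5 ∈ S) : diff₂ * diff₃ ∈ S := by
  have hu : unitFrac ∈ S := S.algebraMap_mem _
  have n (k : ℕ) : (k : Poly) ∈ S := natCast_mem S k
  have e : 5 * (diff₂ * diff₃) ∈ S := by
    rw [diff₂_mul_diff₃_eq]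
    exact S.mul_mem (S.mul_mem (n 48) hu) (S.sub_mem (S.mul_mem (S.mul_mem (n 225) h₂) h₃)
      (S.mul_mem (n 2) h₅))
  have := S.smul_mem e (1 / 5 : ℂ)
  have e' : 5 * (diff₂ * diff₃) = (5 : ℂ) • (diff₂ * diff₃) := by
    rw [ofNat_smul_eq_nsmul]; simp
  rwa [e', smul_smul, show (1 / 5 * 5 : ℂ) = 1 by norm_num, one_smul] at this

theorem presentation_surjective : Function.Surjective presentation := by
  let S : Subalgebra ℂ Poly := (invariantRing.val.comp presentation).range
  have hmem (i : Fin 5) : (presentation (X i) : Poly) ∈ S := ⟨X i, rfl⟩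
  have h₂ : sigmaTilde 2 ∈ S := by simpa [presentation, sigma] using hmem 0
  have h₃ : sigmaTilde 3 ∈ S := by simpa [presentation, sigma] using hmem 1
  have h₄ : sigmaTilde 4 ∈ S := by simpa [presentation, sigma] using hmem 2
  have h₅ : sigmaTilde 5 ∈ S := by simpa [presentation, sigma] using hmem 3
  have h₆ : sigmaTilde 6 ∈ S := by simpa [presentation, sigma] using hmem 4
  obtain ⟨s₂, s₃, d₂, d₃⟩ := basic_mem S h₂ h₃ h₄ h₆
  have hle := invariantRing_le S s₂ s₃ d₂ (diff₂_mul_diff₃_mem S s₂ s₃ h₅) d₃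
  intro x
  obtain ⟨f, hf⟩ := hle x.2
  exact ⟨f, Subtype.ext hf⟩

/-! ### Algebraic independence through integrality. -/

/-- The algebraically independent generators. -/
def primary : Fin 4 → Poly := ![sigmaTilde 2, sigmaTilde 3, sigmaTilde 4, sigmaTilde 6]

theorem isIntegral_of_two_mul {K A : Type*} [CommRing K] [CommRing A] [Algebra K A] {u : K}
    (hu : 2 * u = 1) {x : A} (hx : IsIntegral K (2 * x)) : IsIntegral K x := by
  have e : x = algebraMap K A u * (2 * x) := by
    have h := congrArg (algebraMap K A) hu
    rw [map_mul, map_ofNat, map_one] at h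
    linear_combination -x * h
  rw [e]
  exact isIntegral_algebraMap.mul hx

/-- The square of x³ - y³ is (x³ + y³)² - 4(xy)³, so x³ - y³ is integral, and x³, y³ follow on
halving. -/
theorem isIntegral_of_mul_of_cube_add_cube {K A : Type*} [CommRing K] [CommRing A] [Algebra K A]
    {u : K} (hu : 2 * u = 1) {x y : A} (h₁ : IsIntegral K (x * y))
    (h₂ : IsIntegral K (x ^ 3 + y ^ 3)) : IsIntegral K x ∧ IsIntegral K y := by
  have e : IsIntegral K ((x ^ 3 - y ^ 3) ^ 2) := by
    have : (x ^ 3 - y ^ 3) ^ 2 = (x ^ 3 + y ^ 3) ^ 2 - ((x * y) ^ 3 + (x * y) ^ 3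
      + (x * y) ^ 3 + (x * y) ^ 3) := by ring
    rw [this]
    have h := h₁.pow 3
    exact (h₂.pow 2).sub (((h.add h).add h).add h)
  have e' : IsIntegral K (x ^ 3 - y ^ 3) := e.of_pow (by norm_num)
  constructor
  · have : 2 * x ^ 3 = (x ^ 3 + y ^ 3) + (x ^ 3 - y ^ 3) := by ring
    exact (isIntegral_of_two_mul hu (this ▸ h₂.add e')).of_pow (n := 3) (by norm_num)
  · have : 2 * y ^ 3 = (x ^ 3 + y ^ 3) - (x ^ 3 - y ^ 3) := by ring
    exact (isIntegral_of_two_mul hu (this ▸ h₂.sub e')).of_pow (n := 3) (by norm_num)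

theorem isIntegral_of_add_of_sub_sq {K A : Type*} [CommRing K] [CommRing A] [Algebra K A]
    {u : K} (hu : 2 * u = 1) {x y : A} (h₁ : IsIntegral K (x + y))
    (h₂ : IsIntegral K ((x - y) ^ 2)) : IsIntegral K x ∧ IsIntegral K y := by
  have h : IsIntegral K (x - y) := h₂.of_pow (by norm_num)
  constructor
  · have : 2 * x = (x + y) + (x - y) := by ring
    exact isIntegral_of_two_mul hu (this ▸ h₁.add h)
  · have : 2 * y = (x + y) - (x - y) := by ring
    exact isIntegral_of_two_mul hu (this ▸ h₁.sub h)

theorem coord_isIntegral {K : Subalgebra ℂ Poly} (h₂ : sum₂ ∈ K) (h₃ : sum₃ ∈ K)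
    (h₄ : diff₂ ^ 2 ∈ K) (h₆ : diff₃ ^ 2 ∈ K) :
    IsIntegral K ya ∧ IsIntegral K yb ∧ IsIntegral K yc ∧ IsIntegral K yd := by
  have hu : 2 * algebraMap ℂ K (1 / 2) = 1 := by
    rw [← map_ofNat (algebraMap ℂ K) 2, ← map_mul]; norm_num
  obtain ⟨p₂, q₂⟩ := isIntegral_of_add_of_sub_sq hu
    (isIntegral_algebraMap (A := Poly) (x := (⟨sum₂, h₂⟩ : K)))
    (isIntegral_algebraMap (A := Poly) (x := (⟨diff₂ ^ 2, h₄⟩ : K)))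
  obtain ⟨p₃, q₃⟩ := isIntegral_of_add_of_sub_sq hu
    (isIntegral_algebraMap (A := Poly) (x := (⟨sum₃, h₃⟩ : K)))
    (isIntegral_algebraMap (A := Poly) (x := (⟨diff₃ ^ 2, h₆⟩ : K)))
  obtain ⟨ha, hd⟩ := isIntegral_of_mul_of_cube_add_cube hu p₂ p₃
  obtain ⟨hb, hc⟩ := isIntegral_of_mul_of_cube_add_cube hu q₂ q₃
  exact ⟨ha, hb, hc, hd⟩

/-- Four elements over which a ring of transcendence degree 4 is algebraic must form a transcendence
basis. -/
theorem algebraicIndependent_primary : AlgebraicIndependent ℂ primary := by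
  let K := Algebra.adjoin ℂ (Set.range primary)
  have hK (i : Fin 4) : primary i ∈ K := Algebra.subset_adjoin ⟨i, rfl⟩
  obtain ⟨s₂, s₃, d₂, d₃⟩ := basic_mem K (hK 0) (hK 1) (hK 2) (hK 3)
  obtain ⟨ha, hb, hc, hd⟩ := coord_isIntegral s₂ s₃ d₂ d₃
  have hint : Algebra.IsIntegral K Poly := by
    refine ⟨fun x => ?_⟩
    have hx : x ∈ Algebra.adjoin ℂ {ya, yb, yc, yd} := by rw [adjoin_coord]; trivial
    induction hx using Algebra.adjoin_induction with
    | mem x hx =>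
      simp only [Set.mem_insert_iff, Set.mem_singleton_iff] at hx
      rcases hx with rfl | rfl | rfl | rfl
      exacts [ha, hb, hc, hd]
    | algebraMap z => exact isIntegral_algebraMap (x := algebraMap ℂ K z)
    | add x y _ _ hx hy => exact hx.add hy
    | mul x y _ _ hx hy => exact hx.mul hy
  have : Algebra.IsAlgebraic (Algebra.adjoin ℂ (Set.range primary)) Poly := hint.isAlgebraic
  refine (Algebra.IsAlgebraic.isTranscendenceBasis_of_lift_le_trdeg_of_finite ℂ primary ?_).1
  rw [MvPolynomial.trdeg_of_isDomain]
  simp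


/-! ### The relation and its uniqueness. -/

/-- If g ≠ 0, the multiplicity of p is even on the left and odd on the right. -/
theorem eq_zero_of_sq_eq_prime_mul {R : Type*} [CommRing R] [IsDomain R] [WfDvdMonoid R]
    {p e h g : R} (hp : Prime p) (he : ¬p ∣ e) (hh : h ^ 2 = p * e * g ^ 2) : g = 0 := by
  by_contra hg
  have he0 : e ≠ 0 := fun h => he (h ▸ dvd_zero p)
  have hh0 : h ≠ 0 := by
    rintro rfl
    simp [hp.ne_zero, he0, hg] at hh
  have fin {x : R} (hx : x ≠ 0) : FiniteMultiplicity p x :=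
    FiniteMultiplicity.of_not_isUnit hp.not_isUnit hx
  have hr : p * e * g ^ 2 ≠ 0 := by rw [← hh]; exact pow_ne_zero 2 hh0
  have := congrArg (multiplicity p) hh
  rw [(fin hh0).multiplicity_pow hp, multiplicity_mul hp (fin hr),
    multiplicity_mul hp (fin (left_ne_zero_of_mul hr)), (fin hg).multiplicity_pow hp,
    multiplicity_self, multiplicity_eq_zero.2 he] at this
  omega

/-- The factor `x₄ - x₂² / 4` of the discriminant of the relation with respect to `x₅`. -/
def discLeft : MvPolynomial (Fin 4) ℂ := X 2 - C (1 / 4) * X 0 ^ 2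

/-- The other factor of the discriminant of the relation with respect to `x₅`. -/
def discRight : MvPolynomial (Fin 4) ℂ :=
  -(C (275 / 108) * X 1 ^ 2)
    - (-C (125 / 432) * X 0 ^ 3 + C (175 / 72) * X 0 * X 2 - C (25 / 6) * X 3)

/-- A triangular automorphism carries the variable x₄ to this polynomial. -/
theorem prime_discLeft : Prime discLeft := by
  let f : MvPolynomial (Fin 4) ℂ →ₐ[ℂ] MvPolynomial (Fin 4) ℂ :=
    aeval ![X 0, X 1, X 2 - C (1 / 4) * X 0 ^ 2, X 3]
  let g : MvPolynomial (Fin 4) ℂ →ₐ[ℂ] MvPolynomial (Fin 4) ℂ :=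
    aeval ![X 0, X 1, X 2 + C (1 / 4) * X 0 ^ 2, X 3]
  have hC (h : MvPolynomial (Fin 4) ℂ →ₐ[ℂ] MvPolynomial (Fin 4) ℂ) (z : ℂ) : h (C z) = C z :=
    h.commutes z
  let e : MvPolynomial (Fin 4) ℂ ≃ₐ[ℂ] MvPolynomial (Fin 4) ℂ := AlgEquiv.ofAlgHom f g
    (by
      refine MvPolynomial.algHom_ext fun i => ?_
      fin_cases i <;> simp [f, g, hC])
    (by
      refine MvPolynomial.algHom_ext fun i => ?_
      fin_cases i <;> simp [f, g, hC])
  have h : e (X 2) = discLeft := by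
    change f (X 2) = discLeft
    simp [f, discLeft]
  rw [← h]
  exact (MulEquiv.prime_iff e.toMulEquiv).2 (X_prime)

theorem not_discLeft_dvd : ¬discLeft ∣ discRight := by
  intro h
  -- At this point `discLeft` vanishes, while `discRight` is 25/6.
  have := map_dvd (eval ![0, 0, 0, 1] : MvPolynomial (Fin 4) ℂ →+* ℂ) h
  simp [discLeft, discRight] at this

/-- The map `xᵢ ↦ σ̃ᵢ` on `ℂ[x₂, x₃, x₄, x₆]`. -/
def primaryHom : MvPolynomial (Fin 4) ℂ →ₐ[ℂ] Poly := aeval primary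

theorem primaryHom_injective : Function.Injective primaryHom := algebraicIndependent_primary

theorem primaryHom_C (z : ℂ) : primaryHom (C z) = C z := primaryHom.commutes z

theorem primaryHom_discLeft : primaryHom discLeft = -27 * diff₂ ^ 2 := by
  have h₁ : (C (1 / 4) : Poly) = (324 : ℕ) * unitFrac := C_eq_unitFrac (by norm_num)
  have h₀ := unitFrac_spec
  have e₀ : primaryHom (X 0) = 18 * sum₂ := by simp [primaryHom, primary, sigmaTilde_two]
  have e₂ : primaryHom (X 2) = 81 * sum₂ ^ 2 - 27 * diff₂ ^ 2 := by
    simp [primaryHom, primary, sigmaTilde_four]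
  simp only [discLeft, map_sub, map_mul, map_pow, primaryHom_C, e₀, e₂]
  rw [h₁]
  push_cast
  linear_combination (-81 * sum₂ ^ 2) * h₀

theorem four_mul_primaryHom_discRight : 4 * primaryHom discRight = -675 * diff₃ ^ 2 := by
  have h₁ : (C (275 / 108) : Poly) = (3300 : ℕ) * unitFrac := C_eq_unitFrac (by norm_num)
  have h₂ : (C (125 / 432) : Poly) = (375 : ℕ) * unitFrac := C_eq_unitFrac (by norm_num)
  have h₃ : (C (175 / 72) : Poly) = (3150 : ℕ) * unitFrac := C_eq_unitFrac (by norm_num)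
  have h₄ : (C (25 / 6) : Poly) = (5400 : ℕ) * unitFrac := C_eq_unitFrac (by norm_num)
  have h₀ := unitFrac_spec
  have e₀ : primaryHom (X 0) = 18 * sum₂ := by simp [primaryHom, primary, sigmaTilde_two]
  have e₁ : primaryHom (X 1) = 9 * sum₃ := by simp [primaryHom, primary, sigmaTilde_three]
  have e₂ : primaryHom (X 2) = 81 * sum₂ ^ 2 - 27 * diff₂ ^ 2 := by
    simp [primaryHom, primary, sigmaTilde_four]
  have e₃ : 2 * primaryHom (X 3) =
      99 * sum₃ ^ 2 - 81 * diff₃ ^ 2 + 891 * sum₂ ^ 3 - 567 * diff₂ ^ 2 * sum₂ := by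
    simpa [primaryHom, primary] using two_mul_sigmaTilde_six
  simp only [discRight, map_sub, map_add, map_neg, map_mul, map_pow, primaryHom_C, e₀, e₁, e₂]
  rw [h₁, h₂, h₃, h₄]
  push_cast
  linear_combination (10800 * unitFrac) * e₃ + (-675 * diff₃ ^ 2) * h₀

/-- `σ̃₅` minus half of the linear coefficient of the relation. -/
def centered : Poly := sigmaTilde 5 - C (25 / 36) * sigmaTilde 2 * sigmaTilde 3

theorem two_mul_centered : 2 * centered = -135 * (diff₂ * diff₃) := by
  have h₁ : (C (25 / 36) : Poly) = (900 : ℕ) * unitFrac := C_eq_unitFrac (by norm_num)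
  rw [centered, sigmaTilde_two, sigmaTilde_three, h₁]
  push_cast
  linear_combination two_mul_sigmaTilde_five - 225 * sum₂ * sum₃ * unitFrac_spec

/-- Both sides are (135/2)² δ₂²δ₃², since 27 · 675 = 135². -/
theorem centered_sq : centered ^ 2 = primaryHom (discLeft * discRight) := by
  have h : 4 * centered ^ 2 = 4 * primaryHom (discLeft * discRight) := by
    rw [map_mul, primaryHom_discLeft]
    linear_combination (2 * centered - 135 * (diff₂ * diff₃)) * two_mul_centered
      + 27 * diff₂ ^ 2 * four_mul_primaryHom_discRight
  exact mul_left_cancel₀ (by norm_num) h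

/-- `1` and `σ̃₅` are linearly independent over `ℂ[σ̃₂, σ̃₃, σ̃₄, σ̃₆]`. -/
theorem eq_zero_of_primaryHom_add {g₀ g₁ : MvPolynomial (Fin 4) ℂ}
    (h : primaryHom g₀ + sigmaTilde 5 * primaryHom g₁ = 0) : g₀ = 0 ∧ g₁ = 0 := by
  -- Replacing σ̃₅ by `centered` moves its correction term into the constant coefficient; squaring
  -- then yields an identity inside ℂ[x₂, x₃, x₄, x₆].
  set f := g₀ + C (25 / 36) * X 0 * X 1 * g₁ with hf
  have h' : primaryHom f = -(centered * primaryHom g₁) := by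
    have e₀ : primaryHom (X 0) = sigmaTilde 2 := by simp [primaryHom, primary]
    have e₁ : primaryHom (X 1) = sigmaTilde 3 := by simp [primaryHom, primary]
    simp only [hf, map_add, map_mul, primaryHom_C, e₀, e₁, centered]
    linear_combination h
  have hsq : f ^ 2 = discLeft * discRight * g₁ ^ 2 := by
    apply primaryHom_injective
    rw [map_pow, h', map_mul _ (discLeft * discRight), map_pow, ← centered_sq]
    ring
  have hg₁ : g₁ = 0 := eq_zero_of_sq_eq_prime_mul prime_discLeft not_discLeft_dvd hsq
  refine ⟨primaryHom_injective ?_, hg₁⟩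
  simpa [hg₁] using h

/-- The inclusion of `ℂ[x₂, x₃, x₄, x₆]` in `ℂ[x₂, x₃, x₄, x₅, x₆]`. -/
def inclusion : MvPolynomial (Fin 4) ℂ →ₐ[ℂ] MvPolynomial (Fin 5) ℂ := rename ![0, 1, 2, 4]

theorem presentation_inclusion (g : MvPolynomial (Fin 4) ℂ) :
    (presentation (inclusion g) : Poly) = primaryHom g := by
  have : (invariantRing.val.comp presentation).comp inclusion = primaryHom := by
    refine MvPolynomial.algHom_ext fun i => ?_
    fin_cases i <;> simp [inclusion, primaryHom, primary, presentation, sigma]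
  exact DFunLike.congr_fun this g

theorem presentation_X_three : (presentation (X 3) : Poly) = sigmaTilde 5 := by
  simp [presentation, sigma]

/-- Completing the square in x₅: the centre 25/36 · x₂x₃ is half of the linear coefficient. -/
theorem relation_eq : relation =
    (X 3 - inclusion (C (25 / 36) * X 0 * X 1)) ^ 2 - inclusion (discLeft * discRight) := by
  have hC (z : ℂ) : inclusion (C z) = C z := inclusion.commutes z
  have h₁ : (C (25 / 18) : MvPolynomial (Fin 5) ℂ) = 2 * C (25 / 36) := by
    rw [show (2 : MvPolynomial (Fin 5) ℂ) = C 2 from (map_ofNat C 2).symm, ← C_mul]; norm_num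
  have h₂ : (C (25 / 162) : MvPolynomial (Fin 5) ℂ) =
      C (275 / 108) * C (1 / 4) - C (25 / 36) ^ 2 := by
    rw [← C_pow, ← C_mul, ← C_sub]; norm_num
  have e (i : Fin 4) : inclusion (X i) = X (![0, 1, 2, 4] i) := by simp [inclusion]
  simp only [relation, discLeft, discRight, map_mul, map_sub, map_add, map_neg, map_pow, hC, e,
    Matrix.cons_val, h₁, h₂]
  ring

theorem presentation_relation : presentation relation = 0 := by
  apply Subtype.ext
  change (invariantRing.val.comp presentation) relation = 0
  rw [relation_eq, map_sub, map_pow, map_sub]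
  simp only [AlgHom.comp_apply, Subalgebra.coe_val, presentation_inclusion, presentation_X_three]
  rw [← centered_sq, map_mul, map_mul, primaryHom_C]
  simp [centered, primaryHom, primary]

/-- Division with remainder by the relation, which is monic of degree `2` in `x₅`. -/
theorem exists_remainder (f : MvPolynomial (Fin 5) ℂ) : ∃ g₀ g₁ q,
    f = inclusion g₀ + X 3 * inclusion g₁ + relation * q := by
  induction f using MvPolynomial.induction_on with
  | C z => exact ⟨C z, 0, 0, by simp [inclusion]⟩
  | add f f' hf hf' =>
    obtain ⟨g₀, g₁, q, rfl⟩ := hf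
    obtain ⟨g₀', g₁', q', rfl⟩ := hf'
    exact ⟨g₀ + g₀', g₁ + g₁', q + q', by simp only [map_add]; ring⟩
  | mul_X f i hf =>
    obtain ⟨g₀, g₁, q, rfl⟩ := hf
    have key (j : Fin 4) : ∃ a b c, (inclusion g₀ + X 3 * inclusion g₁ + relation * q)
        * inclusion (X j) = inclusion a + X 3 * inclusion b + relation * c :=
      ⟨g₀ * X j, g₁ * X j, q * inclusion (X j), by simp only [map_mul]; ring⟩
    have e (j : Fin 4) : inclusion (X j) = X (![0, 1, 2, 4] j) := by simp [inclusion]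
    fin_cases i
    · simpa [e] using key 0
    · simpa [e] using key 1
    · simpa [e] using key 2
    -- Multiplication by x₅ is the only case that creates x₅², which is replaced by 2a x₅ +
    -- (`discLeft` · `discRight` - a²) modulo the relation.
    · set a : MvPolynomial (Fin 4) ℂ := C (25 / 36) * X 0 * X 1 with ha
      refine ⟨(discLeft * discRight - a ^ 2) * g₁, g₀ + 2 * a * g₁,
        q * X 3 + inclusion g₁, ?_⟩
      have h := relation_eq
      rw [← ha] at h
      simp only [map_mul, map_sub, map_add, map_pow, map_ofNat] at h ⊢
      change _ * X 3 = _
      linear_combination (-inclusion g₁) * h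
    · simpa [e] using key 3

theorem ker_presentation : RingHom.ker presentation = Ideal.span {relation} := by
  apply le_antisymm
  · intro f hf
    obtain ⟨g₀, g₁, q, rfl⟩ := exists_remainder f
    rw [RingHom.mem_ker, map_add, map_add, map_mul, map_mul, presentation_relation, zero_mul,
      add_zero] at hf
    have h := congrArg (Subtype.val) hf
    simp only [Subalgebra.coe_add, Subalgebra.coe_mul, presentation_inclusion,
      presentation_X_three] at h
    obtain ⟨rfl, rfl⟩ := eq_zero_of_primaryHom_add h
    rw [map_zero, mul_zero, zero_add, zero_add]
    exact Ideal.mul_mem_right _ _ (Ideal.mem_span_singleton_self _)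
  · rw [Ideal.span_singleton_le_iff_mem]
    exact presentation_relation


/-! ### Graded pieces and the Hilbert series. -/

theorem mk_dvd_mul_one_sub {m : ℕ} (hm : m ≠ 0) :
    (PowerSeries.mk fun n => if m ∣ n then (1 : ℚ) else 0) * (1 - PowerSeries.X ^ m) = 1 := by
  ext n
  rw [mul_sub, mul_one, map_sub, PowerSeries.coeff_mul_X_pow', PowerSeries.coeff_mk,
    PowerSeries.coeff_mk, PowerSeries.coeff_one]
  by_cases hmn : m ≤ n
  · have h : m ∣ n - m ↔ m ∣ n := Nat.dvd_sub_iff_left hmn dvd_rfl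
    have h0 : n ≠ 0 := by omega
    simp [hmn, h0, h]
  · rw [if_neg hmn, sub_zero]
    refine if_congr ⟨fun h => ?_, fun h => h ▸ dvd_zero m⟩ rfl rfl
    by_contra h0
    exact hmn (Nat.le_of_dvd (Nat.pos_of_ne_zero h0) h)

/-- The generating series counting exponents by weight. -/
theorem mk_card_weight {ι : Type*} [Fintype ι] (w : ι → ℕ) (hw : ∀ i, w i ≠ 0) :
    (PowerSeries.mk fun n => (Nat.card {d : ι →₀ ℕ | Finsupp.weight w d = n} : ℚ)) =
      ∏ i, PowerSeries.mk fun n => if w i ∣ n then (1 : ℚ) else 0 := by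
  classical
  ext n
  rw [PowerSeries.coeff_prod, PowerSeries.coeff_mk]
  simp only [PowerSeries.coeff_mk, Finset.prod_boole, Finset.mem_univ, true_imp_iff]
  rw [Finset.sum_boole, ← Fintype.card_coe, ← Nat.card_eq_fintype_card]
  refine congrArg _ (Nat.card_congr ?_)
  -- Exponents dᵢ correspond to the summands dᵢwᵢ of n, which are exactly the multiples of wᵢ.
  refine
    { toFun := fun d => ⟨Finsupp.equivFunOnFinite.symm fun i => d.1 i * w i, ?_⟩
      invFun := fun l => ⟨Finsupp.equivFunOnFinite.symm fun i => l.1 i / w i, ?_⟩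
      left_inv := fun d => ?_
      right_inv := fun l => ?_ }
  · have h := d.2
    simp only [Set.mem_ofPred_eq, Finsupp.weight_apply, smul_eq_mul] at h
    rw [Finsupp.sum_fintype _ _ (by simp)] at h
    simpa using h
  · obtain ⟨l, hl⟩ := l
    simp only [Finset.mem_filter, Finset.mem_finsuppAntidiag] at hl
    simp only [Set.mem_ofPred_eq, Finsupp.weight_apply, smul_eq_mul]
    rw [Finsupp.sum_fintype _ _ (by simp), ← hl.1.1]
    exact Finset.sum_congr rfl fun i _ => by simp [Nat.div_mul_cancel (hl.2 i)]
  · ext i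
    simp [Nat.mul_div_cancel _ (Nat.pos_of_ne_zero (hw i))]
  · obtain ⟨l, hl⟩ := l
    simp only [Finset.mem_filter, Finset.mem_finsuppAntidiag] at hl
    ext i
    simp [Nat.div_mul_cancel (hl.2 i)]

theorem sigmaTilde_isHomogeneous (k : ℕ) : (sigmaTilde k).IsHomogeneous k := by
  have hA : vA.IsHomogeneous 1 := isHomogeneous_X _ _
  have hB : vB.IsHomogeneous 1 := isHomogeneous_X _ _
  have hA' : vA'.IsHomogeneous 1 := isHomogeneous_X _ _
  have hB' : vB'.IsHomogeneous 1 := isHomogeneous_X _ _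
  have p {x : Poly} (hx : x.IsHomogeneous 1) : (x ^ k).IsHomogeneous k := by
    simpa using hx.pow k
  exact ((((((((p hA).add (p hB)).add (p (hA.neg.sub hB))).add (p hA')).add (p hB')).add
    (p (hA'.neg.sub hB'))).add (p (hA.neg.sub hA'))).add (p (hB.neg.sub hB'))).add
    (p (((hA.add hB).add hA').add hB'))

/-- Taking the part of degree n of the image amounts to discarding the monomials of g whose weight
is not n. -/
theorem homogeneousComponent_map {σ τ R : Type*} [CommRing R]
    (L : MvPolynomial σ R →ₗ[R] MvPolynomial τ R) (δ : (σ →₀ ℕ) → ℕ)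
    (hL : ∀ d c, (L (monomial d c)).IsHomogeneous (δ d)) (n : ℕ) (g : MvPolynomial σ R) :
    ∃ g' ∈ restrictSupport R {d | δ d = n}, homogeneousComponent n (L g) = L g' := by
  induction g using MvPolynomial.induction_on' with
  | monomial d c =>
    by_cases h : δ d = n
    · refine ⟨monomial d c, (monomial_mem_restrictSupport R).2 (Or.inl h), ?_⟩
      rw [homogeneousComponent_of_mem (hL d c), if_pos h.symm]
    · refine ⟨0, Submodule.zero_mem _, ?_⟩
      rw [homogeneousComponent_of_mem (hL d c), if_neg (Ne.symm h), map_zero]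
  | add p q hp hq =>
    obtain ⟨p', hp', ep⟩ := hp
    obtain ⟨q', hq', eq⟩ := hq
    exact ⟨p' + q', Submodule.add_mem _ hp' hq', by simp only [map_add, ep, eq]⟩

theorem isHomogeneous_map {σ τ R : Type*} [CommRing R]
    (L : MvPolynomial σ R →ₗ[R] MvPolynomial τ R) (δ : (σ →₀ ℕ) → ℕ)
    (hL : ∀ d c, (L (monomial d c)).IsHomogeneous (δ d)) {n : ℕ} {g : MvPolynomial σ R}
    (hg : g ∈ restrictSupport R {d | δ d = n}) : (L g).IsHomogeneous n := by
  suffices h : restrictSupport R {d | δ d = n} ≤ (homogeneousSubmodule τ R n).comap L from h hg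
  rw [restrictSupport_eq_span, Submodule.span_le]
  rintro _ ⟨d, hd, rfl⟩
  have hd' : δ d = n := hd
  exact hd' ▸ hL d 1

/-- The degrees of the algebraically independent generators. -/
def primaryDegree : Fin 4 → ℕ := ![2, 3, 4, 6]

theorem primaryHom_monomial (d : Fin 4 →₀ ℕ) (c : ℂ) :
    (primaryHom (monomial d c)).IsHomogeneous (Finsupp.weight primaryDegree d) := by
  have h (i : Fin 4) : (primary i).IsHomogeneous (primaryDegree i) := by
    fin_cases i <;> exact sigmaTilde_isHomogeneous _
  rw [primaryHom, aeval_monomial, Finsupp.weight_apply, ← zero_add (Finsupp.sum _ _)]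
  refine (isHomogeneous_C _ c).mul (IsHomogeneous.prod _ _ _ fun i _ => ?_)
  change (primary i ^ d i).IsHomogeneous (d i * primaryDegree i)
  rw [mul_comm]
  exact (h i).pow _

/-- The decomposition of the invariant ring over `ℂ[σ̃₂, σ̃₃, σ̃₄, σ̃₆]`. -/
def decomposition : MvPolynomial (Fin 4) ℂ × MvPolynomial (Fin 4) ℂ →ₗ[ℂ] Poly :=
  LinearMap.coprod primaryHom.toLinearMap
    (LinearMap.mulLeft ℂ (sigmaTilde 5) ∘ₗ primaryHom.toLinearMap)

theorem decomposition_apply (g : MvPolynomial (Fin 4) ℂ × MvPolynomial (Fin 4) ℂ) :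
    decomposition g = primaryHom g.1 + sigmaTilde 5 * primaryHom g.2 := rfl

theorem decomposition_injective : Function.Injective decomposition := by
  rw [injective_iff_map_eq_zero]
  rintro ⟨g₀, g₁⟩ h
  obtain ⟨rfl, rfl⟩ := eq_zero_of_primaryHom_add h
  rfl

theorem decomposition_mem (g : MvPolynomial (Fin 4) ℂ × MvPolynomial (Fin 4) ℂ) :
    decomposition g ∈ invariantRing := by
  rw [decomposition_apply, ← presentation_inclusion, ← presentation_inclusion]
  exact invariantRing.add_mem (presentation _).2
    (invariantRing.mul_mem (sigmaTilde_mem 5) (presentation _).2)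

theorem exists_decomposition (x : invariantRing) : ∃ g, decomposition g = x := by
  obtain ⟨f, rfl⟩ := presentation_surjective x
  obtain ⟨g₀, g₁, q, rfl⟩ := exists_remainder f
  refine ⟨(g₀, g₁), ?_⟩
  rw [map_add, map_add, map_mul, map_mul, presentation_relation, zero_mul, add_zero,
    decomposition_apply, Subalgebra.coe_add, Subalgebra.coe_mul, presentation_inclusion,
    presentation_inclusion, presentation_X_three]

/-- The exponents of weight `n`. -/
abbrev exponents (n : ℕ) : Set (Fin 4 →₀ ℕ) := {d | Finsupp.weight primaryDegree d = n}

/-- The exponents of weight `n - 5`. -/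
abbrev shiftedExponents (n : ℕ) : Set (Fin 4 →₀ ℕ) :=
  {d | Finsupp.weight primaryDegree d + 5 = n}

/-- The decomposition P ⊕ σ̃₅P respects degrees, the second summand being shifted by 5. -/
theorem map_gradedPart (n : ℕ) : (gradedPart n).map invariantRing.val.toLinearMap =
    ((restrictSupport ℂ (exponents n)).prod (restrictSupport ℂ (shiftedExponents n))).map
      decomposition := by
  have h₂ (d : Fin 4 →₀ ℕ) (c : ℂ) :
      ((LinearMap.mulLeft ℂ (sigmaTilde 5) ∘ₗ primaryHom.toLinearMap)
        (monomial d c)).IsHomogeneous (Finsupp.weight primaryDegree d + 5) := by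
    rw [add_comm]
    exact (sigmaTilde_isHomogeneous 5).mul (primaryHom_monomial d c)
  apply le_antisymm
  · rintro _ ⟨x, hx, rfl⟩
    obtain ⟨⟨g₀, g₁⟩, hg⟩ := exists_decomposition x
    obtain ⟨g₀', h₀', e₀⟩ := homogeneousComponent_map primaryHom.toLinearMap _
      primaryHom_monomial n g₀
    obtain ⟨g₁', h₁', e₁⟩ := homogeneousComponent_map _ _ h₂ n g₁
    refine ⟨(g₀', g₁'), ⟨h₀', h₁'⟩, ?_⟩
    have hx' : (x : Poly) ∈ homogeneousSubmodule (Fin 4) ℂ n := hx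
    have h := homogeneousComponent_of_mem (m := n) hx'
    rw [if_pos rfl, ← hg] at h
    change decomposition (g₀', g₁') = (x : Poly)
    rw [← hg, ← h, decomposition, LinearMap.coprod_apply, LinearMap.coprod_apply,
      (homogeneousComponent n).map_add, e₀, e₁]
  · rintro _ ⟨⟨g₀, g₁⟩, ⟨h₀, h₁⟩, rfl⟩
    refine ⟨⟨_, decomposition_mem (g₀, g₁)⟩, ?_, rfl⟩
    exact (isHomogeneous_map primaryHom.toLinearMap _ primaryHom_monomial h₀).add
      (isHomogeneous_map _ _ h₂ h₁)

/-- A product of submodules is equivalent to the product of the modules. -/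
def submoduleProdEquiv {R M N : Type*} [Semiring R] [AddCommMonoid M] [AddCommMonoid N] [Module R M]
    [Module R N] (p : Submodule R M) (q : Submodule R N) : p.prod q ≃ₗ[R] p × q where
  toFun x := (⟨x.1.1, x.2.1⟩, ⟨x.1.2, x.2.2⟩)
  map_add' _ _ := rfl
  map_smul' _ _ := rfl
  invFun y := ⟨(y.1, y.2), y.1.2, y.2.2⟩
  left_inv _ := rfl
  right_inv _ := rfl

/-- The graded parts of the invariant ring, in terms of monomials. -/
def gradedPartEquiv (n : ℕ) : gradedPart n ≃ₗ[ℂ]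
    restrictSupport ℂ (exponents n) × restrictSupport ℂ (shiftedExponents n) :=
  (Submodule.equivMapOfInjective _ Subtype.val_injective (gradedPart n)).trans
    ((LinearEquiv.ofEq _ _ (map_gradedPart n)).trans
      ((Submodule.equivMapOfInjective _ decomposition_injective _).symm.trans
        (submoduleProdEquiv _ _)))

theorem finite_exponents (n : ℕ) : (exponents n).Finite :=
  Finsupp.finite_of_nat_weight_eq _ (by decide) n

theorem finite_shiftedExponents (n : ℕ) : (shiftedExponents n).Finite :=
  (Finsupp.finite_of_nat_weight_le primaryDegree (by decide) n).subset
    fun d (hd : _ + 5 = n) => by rw [Set.mem_ofPred_eq]; omega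

theorem finite_gradedPart (n : ℕ) : Module.Finite ℂ (gradedPart n) := by
  have := (finite_exponents n).to_subtype
  have := (finite_shiftedExponents n).to_subtype
  have := Module.Finite.of_basis (basisRestrictSupport ℂ (exponents n))
  have := Module.Finite.of_basis (basisRestrictSupport ℂ (shiftedExponents n))
  exact Module.Finite.equiv (gradedPartEquiv n).symm

theorem finrank_gradedPart (n : ℕ) : Module.finrank ℂ (gradedPart n) =
    Nat.card (exponents n) + Nat.card (shiftedExponents n) := by
  have := (finite_exponents n).to_subtype
  have := (finite_shiftedExponents n).to_subtype
  have := Module.Finite.of_basis (basisRestrictSupport ℂ (exponents n))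
  have := Module.Finite.of_basis (basisRestrictSupport ℂ (shiftedExponents n))
  rw [(gradedPartEquiv n).finrank_eq, Module.finrank_prod,
    Module.finrank_eq_nat_card_basis (basisRestrictSupport ℂ (exponents n)),
    Module.finrank_eq_nat_card_basis (basisRestrictSupport ℂ (shiftedExponents n))]

theorem hilbertSeries_eq : hilbertSeries =
    (1 + PowerSeries.X ^ 5) *
      ((1 - PowerSeries.X ^ 2) * (1 - PowerSeries.X ^ 3) * (1 - PowerSeries.X ^ 4)
        * (1 - PowerSeries.X ^ 6))⁻¹ := by
  have h : hilbertSeries = (1 + PowerSeries.X ^ 5) *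
      PowerSeries.mk fun n => (Nat.card (exponents n) : ℚ) := by
    ext n
    rw [hilbertSeries, PowerSeries.coeff_mk, add_mul, one_mul, map_add, PowerSeries.coeff_mk,
      PowerSeries.coeff_X_pow_mul', finrank_gradedPart, Nat.cast_add]
    congr 1
    split_ifs with hn
    · rw [PowerSeries.coeff_mk]
      have : shiftedExponents n = exponents (n - 5) := by
        ext d; simp only [Set.mem_ofPred_eq]; omega
      rw [this]
    -- For n < 5 there is no contribution: the shift is written as weight + 5 = n, which avoids
    -- truncated subtraction.
    · have : shiftedExponents n = ∅ := by
        ext d; simp only [Set.mem_ofPred_eq, Set.mem_empty_iff_false, iff_false]; omega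
      simp [this]
  rw [h]
  congr 1
  have e : ∏ i, (1 - PowerSeries.X ^ primaryDegree i : PowerSeries ℚ) =
      (1 - PowerSeries.X ^ 2) * (1 - PowerSeries.X ^ 3) * (1 - PowerSeries.X ^ 4)
        * (1 - PowerSeries.X ^ 6) := by
    rw [Fin.prod_univ_four]
    simp only [primaryDegree, Matrix.cons_val]
  rw [PowerSeries.eq_inv_iff_mul_eq_one (by simp), mk_card_weight primaryDegree (by decide),
    ← e, ← Finset.prod_mul_distrib]
  exact Finset.prod_eq_one fun i _ => mk_dvd_mul_one_sub (by fin_cases i <;> decide)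

theorem sigma_ne_zero {i : ℕ} (hi : i ∈ Finset.Icc 2 6) : sigma i ≠ 0 := by
  intro h
  have h' : sigmaTilde i = 0 := congrArg Subtype.val h
  have hp := algebraicIndependent_primary.ne_zero
  fin_cases hi
  · exact hp 0 h'
  · exact hp 1 h'
  · exact hp 2 h'
  -- σ̃₅ = 0 would be a linear dependence 0 + σ̃₅ · 1 = 0 over P.
  · refine one_ne_zero (eq_zero_of_primaryHom_add (g₀ := 0) (g₁ := 1) ?_).2
    rw [show sigmaTilde 5 = 0 from h']; simp
  · exact hp 3 h'

theorem algebraicIndependent_sigma :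
    AlgebraicIndependent ℂ ![sigma 2, sigma 3, sigma 4, sigma 6] := by
  refine AlgebraicIndependent.of_comp invariantRing.val ?_
  convert algebraicIndependent_primary using 1
  funext i
  fin_cases i <;> rfl

end

end WreathInvariants

theorem mainTheorem8 :
    -- generators, and the only relation
    Function.Surjective WreathInvariants.presentation ∧
    RingHom.ker WreathInvariants.presentation = Ideal.span {WreathInvariants.relation} ∧
    -- `σ̃ᵢ` has degree `i`
    (∀ i ∈ Finset.Icc 2 6, WreathInvariants.sigma i ≠ 0 ∧
      WreathInvariants.sigma i ∈ WreathInvariants.gradedPart i) ∧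
    -- the subring `ℂ[σ̃₂, σ̃₃, σ̃₄, σ̃₆]` is a polynomial ring
    AlgebraicIndependent ℂ ![WreathInvariants.sigma 2, WreathInvariants.sigma 3,
      WreathInvariants.sigma 4, WreathInvariants.sigma 6] ∧
    -- the Hilbert series
    (∀ n, Module.Finite ℂ (WreathInvariants.gradedPart n)) ∧
    WreathInvariants.hilbertSeries =
      (1 + PowerSeries.X ^ 5) *
        ((1 - PowerSeries.X ^ 2) * (1 - PowerSeries.X ^ 3) * (1 - PowerSeries.X ^ 4)
          * (1 - PowerSeries.X ^ 6))⁻¹ := by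
  exact ⟨WreathInvariants.presentation_surjective, WreathInvariants.ker_presentation,
    fun i hi => ⟨WreathInvariants.sigma_ne_zero hi, WreathInvariants.sigmaTilde_isHomogeneous i⟩,
    WreathInvariants.algebraicIndependent_sigma, WreathInvariants.finite_gradedPart,
    WreathInvariants.hilbertSeries_eq⟩
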